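/- Let $n\ge 1$, let $\Omega,\widetilde\Omega\subset\mathbb R^n$ be domains (non-empty connected open sets), let $\varphi:\Omega\to\widetilde\Omega$ be a homeomorphism, and let $q>1$ and $n-1<q<p<\infty$. For a set $A\subset\mathbb R^n$, a ring condenser in $A$ is a pair $(F;G)$ with $F\subset G\subset A$, where $F$ is a non-empty connected compact set and $G$ is a connected open set. For a domain $D$, $r\in\{p,q\}$ and $F\subset G\subset D$ with $F$ compact and $G$ open, the $r$-capacity is $$ \operatorname{cap}_r(F;G)=\inf \int_{D}|\nabla f|^r\,dx , $$ where the infimum is taken over all continuous functions $f:D\to\mathbb R$ that are weakly differentiable in $D$ with $\nabla f\in L_r(D)$, have compact support in $G$, and satisfy $f\ge 1$ on $F$. Capacities of condensers in $\widetilde\Omega$ are taken with $D=\widetilde\Omega$, and capacities of their preimages under $\varphi$ with $D=\Omega$. For open sets $\widetilde A\subset\widetilde\Omega$ (bounded or not) put $$ \widetilde\Psi_{p,q}(\widetilde A)=\sup\left(\frac{\operatorname{cap}_q^{1/q}(\varphi^{-1}(F);\varphi^{-1}(G))}{\operatorname{cap}_p^{1/p}(F;G)}\right)^{\frac{pq}{p-q}}\in[0,\infty],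 $$ where the supremum is taken over all ring condensers $(F;G)$ in $\widetilde A$ with $\operatorname{cap}_p(F;G)\neq 0$ (the supremum of the empty family being $0$). Then $\widetilde\Psi_{p,q}$ is non-decreasing, i.e. $\widetilde\Psi_{p,q}(\widetilde A_1)\le\widetilde\Psi_{p,q}(\widetilde A_2)$ for all open sets $\widetilde A_1\subset\widetilde A_2\subset\widetilde\Omega$, and strictly positive, i.e. $\widetilde\Psi_{p,q}(\widetilde A)>0$ for every non-empty open set $\widetilde A\subset\widetilde\Omega$. -/

import Mathlib

open MeasureTheory Set
open scoped ENNReal ContDiff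

namespace RingCap

/-- `g` is the weak gradient of `f` on the open set `Ω`: both are locally integrable on `Ω`, and
`∫_Ω f ∂ᵢη = - ∫_Ω gᵢ η` for every `η ∈ C_c^∞(Ω)` and every coordinate `i`. -/
def IsWeakGradientOn {n : ℕ} (Ω : Set (EuclideanSpace ℝ (Fin n)))
    (f : EuclideanSpace ℝ (Fin n) → ℝ)
    (g : EuclideanSpace ℝ (Fin n) → EuclideanSpace ℝ (Fin n)) : Prop :=
  LocallyIntegrableOn f Ω volume ∧ LocallyIntegrableOn g Ω volume ∧
    ∀ η : EuclideanSpace ℝ (Fin n) → ℝ, ContDiff ℝ ∞ η → HasCompactSupport η → tsupport η ⊆ Ω →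
      ∀ i : Fin n,
        ∫ x in Ω, f x * fderiv ℝ η x (EuclideanSpace.single i 1) = - ∫ x in Ω, g x i * η x

/-- `f ∈ L¹_p(Ω)` with weak gradient `∇f = g`: that is, `f` is locally integrable and weakly
differentiable on `Ω`, and `g ∈ L_p(Ω)`. -/
def MemHomSobolev {n : ℕ} (p : ℝ) (Ω : Set (EuclideanSpace ℝ (Fin n)))
    (f : EuclideanSpace ℝ (Fin n) → ℝ)
    (g : EuclideanSpace ℝ (Fin n) → EuclideanSpace ℝ (Fin n)) : Prop :=
  IsWeakGradientOn Ω f g ∧ MemLp g (ENNReal.ofReal p) (volume.restrict Ω)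

/-- `(F; G)` is a ring condenser in the set `A`: `F ⊆ G ⊆ A` with `F` compact and connected and
`G` open and connected. -/
def IsRingCondenser {n : ℕ} (A F G : Set (EuclideanSpace ℝ (Fin n))) : Prop :=
  F ⊆ G ∧ G ⊆ A ∧ IsCompact F ∧ IsConnected F ∧ IsOpen G ∧ IsConnected G

/-- `f`, a function of `L¹_p(Ω)` with weak gradient `g`, is admissible for `(F; G)`: it is
continuous on `Ω`, has compact support in `G`, and `f ≥ 1` on `F`. Only the values of `f` on `Ω`
matter. -/
def IsAdmissible {n : ℕ} (p : ℝ) (Ω F G : Set (EuclideanSpace ℝ (Fin n)))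
    (f : EuclideanSpace ℝ (Fin n) → ℝ)
    (g : EuclideanSpace ℝ (Fin n) → EuclideanSpace ℝ (Fin n)) : Prop :=
  MemHomSobolev p Ω f g ∧ ContinuousOn f Ω ∧
    (∃ K : Set (EuclideanSpace ℝ (Fin n)), IsCompact K ∧ K ⊆ G ∧ ∀ x ∈ Ω, x ∉ K → f x = 0) ∧
    ∀ x ∈ F, 1 ≤ f x

/-- The `p`-capacity `cap_p(F; G) = inf ‖f | L¹_p(Ω)‖^p = inf (‖∇f | L_p(Ω)‖)^p`, the infimum
being over all admissible functions. -/
noncomputable def capacity {n : ℕ} (p : ℝ) (Ω F G : Set (EuclideanSpace ℝ (Fin n))) : ℝ≥0∞ :=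
  ⨅ (f : EuclideanSpace ℝ (Fin n) → ℝ)
    (g : EuclideanSpace ℝ (Fin n) → EuclideanSpace ℝ (Fin n))
    (_ : IsAdmissible p Ω F G f g),
    eLpNorm g (ENNReal.ofReal p) (volume.restrict Ω) ^ p

/-- The preimage `φ⁻¹(S) ⊆ Ω`, as a subset of `ℝⁿ`, of a set `S ⊆ ℝⁿ` under `φ : Ω → Ω'`. -/
def preim {n : ℕ} {Ω Ω' : Set (EuclideanSpace ℝ (Fin n))} (φ : Ω ≃ₜ Ω')
    (S : Set (EuclideanSpace ℝ (Fin n))) : Set (EuclideanSpace ℝ (Fin n)) :=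
  Subtype.val '' {x : Ω | (φ x : EuclideanSpace ℝ (Fin n)) ∈ S}

/-- The capacitary set function
`Ψ_{p,q}(A) = sup (cap_q^{1/q}(φ⁻¹(F); φ⁻¹(G)) / cap_p^{1/p}(F; G))^{pq/(p-q)}`, with values in
`[0, ∞]`, the supremum being over all ring condensers `(F; G)` in `A` with `cap_p(F; G) ≠ 0`. -/
noncomputable def capSetFun {n : ℕ} {Ω Ω' : Set (EuclideanSpace ℝ (Fin n))} (p q : ℝ)
    (φ : Ω ≃ₜ Ω') (A : Set (EuclideanSpace ℝ (Fin n))) : ℝ≥0∞ :=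
  ⨆ (F : Set (EuclideanSpace ℝ (Fin n))) (G : Set (EuclideanSpace ℝ (Fin n)))
    (_ : IsRingCondenser A F G) (_ : capacity p Ω' F G ≠ 0),
    (capacity q Ω (preim φ F) (preim φ G) ^ (1 / q) / capacity p Ω' F G ^ (1 / p))
      ^ (p * q / (p - q))

end RingCap

/-!
The function `capSetFun` is monotone because enlarging `A` enlarges the family of ring condensers
over which the supremum is taken.

For positivity, one condenser with a non-zero quotient is enough. A closed ball `F` inside a slightly
larger concentric open ball `G`, with closure in `A`, will do. Its capacity is finite, because a
smooth cutoff is admissible (`capacity_ne_top`). What remains is that `cap_p(F; G)` and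
`cap_q(φ⁻¹(F); φ⁻¹(G))` do not vanish. Both follow from `capacity_ne_zero`, which asks only that the
plate have interior points and that the outer set lie in a compact subset of the domain; these two
properties pass to preimages under a homeomorphism, so no finer capacity estimate for continua
enters.

The lower bound in `capacity_ne_zero` is by duality. There is a test function `η` on the domain whose
derivative in a coordinate direction coincides, on the compact set, with a bump `ρ` carried by a ball
inside the plate: it is a cutoff times a primitive of `ρ`
(`exists_contDiff_fderiv_single_nonneg`). Testing the definition of the weak gradient `g` of an
admissible `f` against `η` gives `∫ ρ ≤ ∫ f ∂ᵢη = -∫ gᵢ η`, and Hölder's inequality bounds the right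
side by `‖g‖_r ‖η‖_{r'}`.
-/

namespace RingCap

/-! ### Test functions -/

/-- A smooth primitive, in the direction of the `i`-th coordinate, of a bump function carried by an
arbitrarily small ball. The primitive itself need not have compact support. -/
theorem exists_contDiff_fderiv_single_nonneg {n : ℕ} (i : Fin n) (a : EuclideanSpace ℝ (Fin n))
    {ε : ℝ} (hε : 0 < ε) :
    ∃ η : EuclideanSpace ℝ (Fin n) → ℝ, ContDiff ℝ ∞ η ∧
      (∀ x, 0 ≤ fderiv ℝ η x (EuclideanSpace.single i 1)) ∧
      (∀ x, x ∉ Metric.closedBall a ε → fderiv ℝ η x (EuclideanSpace.single i 1) = 0) ∧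
      ∃ x, fderiv ℝ η x (EuclideanSpace.single i 1) ≠ 0 := by
  -- A smooth step of width `ε` in the `i`-th coordinate, times a cutoff to the cylinder of radius
  -- `ε / 2` around the line through `a` in that direction.
  set S : ℝ → ℝ := Real.smoothTransition with hS
  have hSd : ContDiff ℝ ∞ S := Real.smoothTransition.contDiff
  have hSdiff : Differentiable ℝ S := hSd.differentiable (by simp)
  set χ : EuclideanSpace ℝ (Fin n) → ℝ :=
    fun x => S (1 - (4 / ε ^ 2) * ∑ j ∈ Finset.univ.erase i, (x j - a j) ^ 2) with hχ
  set u : EuclideanSpace ℝ (Fin n) → ℝ := fun x => (x i - a i) / ε + 1 / 2 with hu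
  have hcoord : ∀ j : Fin n, ContDiff ℝ ∞ (fun x : EuclideanSpace ℝ (Fin n) => x j) := fun j =>
    (EuclideanSpace.proj j : EuclideanSpace ℝ (Fin n) →L[ℝ] ℝ).contDiff
  have hη : ContDiff ℝ ∞ (fun x => S (u x) * χ x) := by
    refine (hSd.comp (((hcoord i).sub contDiff_const).div_const _ |>.add contDiff_const)).mul
      (hSd.comp (contDiff_const.sub (contDiff_const.mul (ContDiff.sum fun j _ => ?_))))
    exact ((hcoord j).sub contDiff_const).pow 2
  have hder : ∀ x, fderiv ℝ (fun x => S (u x) * χ x) x (EuclideanSpace.single i 1) =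
      deriv S (u x) / ε * χ x := by
    intro x
    rw [← ((hη.differentiable (by simp)) x).lineDeriv_eq_fderiv]
    refine HasLineDerivAt.lineDeriv ?_
    have h1 : ∀ t : ℝ, χ (x + t • EuclideanSpace.single i 1) = χ x := by
      intro t
      simp only [hχ]
      congr 3
      refine Finset.sum_congr rfl fun j hj => ?_
      simp [Finset.ne_of_mem_erase hj]
    have h2 : ∀ t : ℝ, u (x + t • EuclideanSpace.single i 1) = u x + t / ε := by
      intro t
      simp [hu]
      ring
    unfold HasLineDerivAt
    simp only [h1, h2]
    refine HasDerivAt.mul_const ?_ _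
    have h3 : HasDerivAt (fun t : ℝ => u x + t / ε) (1 / ε) 0 :=
      ((hasDerivAt_id 0).div_const ε).const_add _
    have h4 : HasDerivAt S (deriv S (u x)) (u x + 0 / ε) := by
      simpa using (hSdiff (u x)).hasDerivAt
    simpa [div_eq_mul_inv, Function.comp_def] using h4.comp (0 : ℝ) h3
  refine ⟨fun x => S (u x) * χ x, hη, fun x => ?_, fun x hx => ?_, ?_⟩
  · rw [hder]
    exact mul_nonneg (div_nonneg (Real.smoothTransition.monotone.deriv_nonneg) hε.le)
      (Real.smoothTransition.nonneg _)
  · rw [hder]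
    by_contra hne
    apply hx
    have hd : deriv S (u x) ≠ 0 := fun h => hne (by simp [h])
    have hc : χ x ≠ 0 := fun h => hne (by simp [h])
    have hu0 : 0 ≤ u x := by
      by_contra! h
      refine hd ((Filter.EventuallyEq.deriv_eq (f := fun _ => (0 : ℝ)) ?_).trans (by simp))
      filter_upwards [Iio_mem_nhds h] with t ht
      exact Real.smoothTransition.zero_of_nonpos (le_of_lt ht)
    have hu1 : u x ≤ 1 := by
      by_contra! h
      refine hd ((Filter.EventuallyEq.deriv_eq (f := fun _ => (1 : ℝ)) ?_).trans (by simp))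
      filter_upwards [Ioi_mem_nhds h] with t ht
      exact Real.smoothTransition.one_of_one_le (le_of_lt ht)
    have hc' : 0 < 1 - (4 / ε ^ 2) * ∑ j ∈ Finset.univ.erase i, (x j - a j) ^ 2 := by
      by_contra! h
      exact hc (Real.smoothTransition.zero_of_nonpos h)
    have hi : (x i - a i) ^ 2 ≤ ε ^ 2 / 4 := by
      have h : x i - a i = ε * (u x - 1 / 2) := by simp only [hu]; field_simp; ring
      rw [h]
      have : (u x - 1 / 2) ^ 2 ≤ 1 / 4 := by nlinarith
      nlinarith [sq_nonneg ε]
    have hperp : ∑ j ∈ Finset.univ.erase i, (x j - a j) ^ 2 ≤ ε ^ 2 / 4 := by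
      rw [sub_pos, div_mul_eq_mul_div, div_lt_one (by positivity)] at hc'
      linarith
    rw [Metric.mem_closedBall, EuclideanSpace.dist_eq]
    refine Real.sqrt_le_iff.2 ⟨hε.le, ?_⟩
    simp only [Real.dist_eq, sq_abs]
    rw [← Finset.add_sum_erase _ _ (Finset.mem_univ i)]
    nlinarith [sq_nonneg ε]
  · obtain ⟨t, -, ht⟩ := exists_deriv_eq_slope S (zero_lt_one' ℝ) hSdiff.continuous.continuousOn
      hSdiff.differentiableOn
    have ht1 : deriv S t = 1 := by rw [ht]; simp [hS]
    refine ⟨a + (ε * (t - 1 / 2)) • EuclideanSpace.single i 1, ?_⟩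
    have h1 : u (a + (ε * (t - 1 / 2)) • EuclideanSpace.single i 1) = t := by
      simp [hu]
      field_simp
      ring
    have h2 : χ (a + (ε * (t - 1 / 2)) • EuclideanSpace.single i 1) = 1 := by
      simp only [hχ]
      rw [Finset.sum_eq_zero fun j hj => ?_]
      · simp [hS]
      · simp [Finset.ne_of_mem_erase hj]
    rw [hder, h1, h2, ht1]
    simpa using hε.ne'

theorem exists_contDiff_eventuallyEq_one_of_isCompact {E : Type*}
    [NormedAddCommGroup E] [NormedSpace ℝ E] [FiniteDimensional ℝ E]
    {L Ω : Set E} (hL : IsCompact L) (hΩ : IsOpen Ω) (hLΩ : L ⊆ Ω) :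
    ∃ ψ : E → ℝ, ContDiff ℝ ∞ ψ ∧ HasCompactSupport ψ ∧ tsupport ψ ⊆ Ω ∧
      ∀ x ∈ L, ψ =ᶠ[nhds x] 1 := by
  obtain ⟨M, hM, hLM, hMΩ⟩ := exists_compact_between hL hΩ hLΩ
  obtain ⟨f, hf1, hf0, -⟩ := exists_contMDiffMap_one_nhds_of_subset_interior
    (n := (⊤ : ℕ∞)) (modelWithCornersSelf ℝ E) hL.isClosed hLM
  have hts : tsupport f ⊆ M :=
    closure_minimal (fun x hx => by_contra fun h => hx (hf0 x h)) hM.isClosed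
  exact ⟨f, f.contMDiff.contDiff, HasCompactSupport.of_support_subset_isCompact hM
    (subset_tsupport _ |>.trans hts), hts.trans hMΩ,
    fun x hx => Filter.Eventually.filter_mono (nhds_le_nhdsSet hx) hf1⟩

/-! ### Bounds for the capacity -/

/-- The pairing of a `Lʳ` vector field with a test function is bounded by Hölder's inequality. -/
theorem enorm_integral_apply_mul_le {n : ℕ} {Ω : Set (EuclideanSpace ℝ (Fin n))} {r : ℝ≥0∞}
    (hr : 1 ≤ r) (i : Fin n)
    {g : EuclideanSpace ℝ (Fin n) → EuclideanSpace ℝ (Fin n)}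
    (hg : AEStronglyMeasurable g (volume.restrict Ω)) {η : EuclideanSpace ℝ (Fin n) → ℝ}
    (hη : AEStronglyMeasurable η (volume.restrict Ω)) :
    ‖∫ x in Ω, g x i * η x‖ₑ ≤ eLpNorm g r (volume.restrict Ω) *
      eLpNorm η r.conjExponent (volume.restrict Ω) := by
  have : r.HolderConjugate r.conjExponent := ENNReal.HolderConjugate.conjExponent hr
  calc ‖∫ x in Ω, g x i * η x‖ₑ ≤ ∫⁻ x in Ω, ‖g x i * η x‖ₑ := enorm_integral_le_lintegral_enorm _
    _ = eLpNorm (fun x => g x i * η x) 1 (volume.restrict Ω) :=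
        eLpNorm_one_eq_lintegral_enorm.symm
    _ ≤ (1 : NNReal) * eLpNorm g r (volume.restrict Ω) *
          eLpNorm η r.conjExponent (volume.restrict Ω) := by
        refine eLpNorm_le_eLpNorm_mul_eLpNorm'_of_norm hg hη (fun v t => v i * t) 1
          (.of_forall fun x => ?_)
        rw [norm_mul, NNReal.coe_one, one_mul]
        gcongr
        exact PiLp.norm_apply_le _ _
    _ = _ := by simp

/-- A condenser in `Ω` has positive capacity if its plate has interior points and its outer set is
relatively compact in `Ω`. The compact set `L` makes room for a cutoff equal to `1` near the support
of every admissible function, and the interior of `F` for a bump `ρ`: a single test function `η`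
with `∂ᵢη = ρ` on `L` then gives `∫ ρ ≤ ∫ f ∂ᵢη = -∫ gᵢ η ≤ ‖g‖_r ‖η‖_{r'}` for all admissible `f`,
whatever the sign of `f` off `F`. -/
theorem capacity_ne_zero {n : ℕ} (hn : 1 ≤ n) {r : ℝ} (hr : 1 < r)
    {Ω F G L : Set (EuclideanSpace ℝ (Fin n))} (hΩ : IsOpen Ω) (hL : IsCompact L) (hGL : G ⊆ L)
    (hLΩ : L ⊆ Ω) (hFΩ : F ⊆ Ω) (hF : (interior F).Nonempty) : capacity r Ω F G ≠ 0 := by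
  obtain ⟨a, ha⟩ := hF
  obtain ⟨ε, hε, hball⟩ := Metric.nhds_basis_closedBall.mem_iff.1 (isOpen_interior.mem_nhds ha)
  replace hball : Metric.closedBall a ε ⊆ F := hball.trans interior_subset
  set i : Fin n := ⟨0, hn⟩
  obtain ⟨η₀, hη₀, hnn, hsupp, x₀, hx₀⟩ := exists_contDiff_fderiv_single_nonneg i a hε
  obtain ⟨ψ, hψ, hψc, hψΩ, hψ1⟩ := exists_contDiff_eventuallyEq_one_of_isCompact hL hΩ hLΩ
  set η : EuclideanSpace ℝ (Fin n) → ℝ := fun x => ψ x * η₀ x with hηdef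
  set ρ : EuclideanSpace ℝ (Fin n) → ℝ := fun x => fderiv ℝ η₀ x (EuclideanSpace.single i 1)
    with hρ
  have hη : ContDiff ℝ ∞ η := hψ.mul hη₀
  have hηc : HasCompactSupport η := hψc.mul_right
  have hηΩ : tsupport η ⊆ Ω := (tsupport_mul_subset_left (f := ψ) (g := η₀)).trans hψΩ
  have hρcont : Continuous ρ := (hη₀.continuous_fderiv (by simp)).clm_apply continuous_const
  have hρc : HasCompactSupport ρ :=
    HasCompactSupport.intro (isCompact_closedBall a ε) hsupp
  have hρpos : 0 < ∫ x, ρ x :=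
    hρcont.integral_pos_of_hasCompactSupport_nonneg_nonzero hρc hnn hx₀
  set C := eLpNorm η (ENNReal.ofReal r).conjExponent (volume.restrict Ω)
  have hC : C ≠ ⊤ :=
    (hη.continuous.memLp_of_hasCompactSupport hηc).eLpNorm_ne_top
  -- The dual bound `∫ ρ ≤ ‖g‖ C` for every admissible pair `(f, g)`.
  have key : ∀ f g, IsAdmissible r Ω F G f g →
      ENNReal.ofReal (∫ x, ρ x) / C ≤ eLpNorm g (ENNReal.ofReal r) (volume.restrict Ω) := by
    rintro f g ⟨⟨⟨-, -, hfg⟩, hg⟩, hfc, ⟨K, -, hKG, hK0⟩, hf1⟩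
    refine ENNReal.div_le_of_le_mul ?_
    -- On the support of `f` the cutoff `ψ` is locally `1`, so `∂ᵢη` is the bump `ρ` there.
    have hsplit : ∀ x ∈ Ω, f x * fderiv ℝ η x (EuclideanSpace.single i 1) = f x * ρ x := by
      intro x hx
      by_cases hxK : x ∈ K
      · have : η =ᶠ[nhds x] η₀ := by
          filter_upwards [hψ1 x (hGL (hKG hxK))] with y hy
          simp [hηdef, hy]
        rw [this.fderiv_eq]
      · simp [hK0 x hx hxK]
    have hfρ : ∀ x ∈ Ω, ρ x ≤ f x * ρ x := by
      intro x hx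
      by_cases hxb : x ∈ Metric.closedBall a ε
      · exact le_mul_of_one_le_left (hnn x) (hf1 x (hball hxb))
      · simp [hρ, hsupp x hxb]
    have hint : IntegrableOn (fun x => f x * ρ x) Ω := by
      refine (integrableOn_iff_integrable_of_support_subset (s := Metric.closedBall a ε) ?_).1 ?_
        |>.integrableOn
      · intro x hx
        by_contra h
        exact hx (by simp [hρ, hsupp x h])
      · exact ((hfc.mono (hball.trans hFΩ)).mul hρcont.continuousOn).integrableOn_compact
          (isCompact_closedBall a ε)
    have hle : ∫ x, ρ x ≤ ∫ x in Ω, f x * fderiv ℝ η x (EuclideanSpace.single i 1) := by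
      rw [setIntegral_congr_fun hΩ.measurableSet hsplit,
        ← setIntegral_eq_integral_of_forall_compl_eq_zero (s := Ω) (f := ρ) fun x hx =>
          hsupp x fun h => hx (hFΩ (hball h))]
      exact setIntegral_mono_on (hρcont.integrable_of_hasCompactSupport hρc).integrableOn hint
        hΩ.measurableSet hfρ
    rw [hfg η hη hηc hηΩ i] at hle
    calc ENNReal.ofReal (∫ x, ρ x) ≤ ENNReal.ofReal ‖∫ x in Ω, g x i * η x‖ :=
          ENNReal.ofReal_le_ofReal (hle.trans (neg_le_abs _))
      _ = ‖∫ x in Ω, g x i * η x‖ₑ := ofReal_norm _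
      _ ≤ _ := enorm_integral_apply_mul_le (by simpa using hr.le) i hg.aestronglyMeasurable
          hη.continuous.aestronglyMeasurable
  have hpos : 0 < (ENNReal.ofReal (∫ x, ρ x) / C) ^ r := by
    refine ENNReal.rpow_pos_of_nonneg (ENNReal.div_pos ?_ hC) (by linarith)
    simpa using hρpos
  refine (hpos.trans_le ?_).ne'
  refine le_iInf fun f => le_iInf fun g => le_iInf fun h => ?_
  exact ENNReal.rpow_le_rpow (key f g h) (by linarith)

/-- The gradient of a smooth function is its weak gradient. -/
theorem isWeakGradientOn_gradient {n : ℕ} {Ω : Set (EuclideanSpace ℝ (Fin n))}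
    {f : EuclideanSpace ℝ (Fin n) → ℝ} (hf : ContDiff ℝ ∞ f) :
    IsWeakGradientOn Ω f (gradient f) := by
  have hfd : Differentiable ℝ f := hf.differentiable (by simp)
  have hcont' : Continuous (fderiv ℝ f) := hf.continuous_fderiv (by simp)
  have hcont : Continuous (gradient f) :=
    (InnerProductSpace.toDual ℝ (EuclideanSpace ℝ (Fin n))).symm.continuous.comp hcont'
  refine ⟨hf.continuous.locallyIntegrable.locallyIntegrableOn _,
    hcont.locallyIntegrable.locallyIntegrableOn _, fun η hη hηc hηΩ i => ?_⟩
  have hg : ∀ x, gradient f x i = fderiv ℝ f x (EuclideanSpace.single i 1) := by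
    intro x
    have h := InnerProductSpace.toDual_symm_apply (𝕜 := ℝ)
      (x := EuclideanSpace.single i (1 : ℝ)) (y := fderiv ℝ f x)
    rw [EuclideanSpace.inner_single_right] at h
    simpa [gradient] using h
  have hη0 : ∀ x, x ∉ Ω → η x = 0 := fun x hx => image_eq_zero_of_notMem_tsupport (hx <| hηΩ ·)
  have hη0' : ∀ x, x ∉ Ω → fderiv ℝ η x = 0 := fun x hx =>
    image_eq_zero_of_notMem_tsupport fun h => hx (hηΩ (tsupport_fderiv_subset ℝ h))
  rw [setIntegral_eq_integral_of_forall_compl_eq_zero (fun x hx => by simp [hη0' x hx]),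
    setIntegral_eq_integral_of_forall_compl_eq_zero (fun x hx => by simp [hη0 x hx])]
  simp only [hg]
  have hηd : Continuous fun x => fderiv ℝ η x (EuclideanSpace.single i 1) :=
    (hη.continuous_fderiv (by simp)).clm_apply continuous_const
  have hfdc : Continuous fun x => fderiv ℝ f x (EuclideanSpace.single i 1) :=
    hcont'.clm_apply continuous_const
  refine integral_mul_fderiv_eq_neg_fderiv_mul_of_integrable ?_ ?_ ?_ (fun x _ => hfd x)
    (fun x _ => hη.differentiable (by simp) x)
  · exact (hfdc.mul hη.continuous).integrable_of_hasCompactSupport hηc.mul_left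
  · exact (hf.continuous.mul hηd).integrable_of_hasCompactSupport
      (hηc.fderiv_apply ℝ _).mul_left
  · exact (hf.continuous.mul hη.continuous).integrable_of_hasCompactSupport hηc.mul_left

/-- A smooth cutoff between `F` and `G` is admissible. -/
theorem capacity_ne_top {n : ℕ} {r : ℝ} (hr : 0 ≤ r) {Ω F G : Set (EuclideanSpace ℝ (Fin n))}
    (hF : IsCompact F) (hG : IsOpen G) (hFG : F ⊆ G) : capacity r Ω F G ≠ ⊤ := by
  obtain ⟨ψ, hψ, hψc, hψG, hψ1⟩ := exists_contDiff_eventuallyEq_one_of_isCompact hF hG hFG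
  have hcont : Continuous (gradient ψ) :=
    (InnerProductSpace.toDual ℝ (EuclideanSpace ℝ (Fin n))).symm.continuous.comp
      (hψ.continuous_fderiv (by simp))
  have hgc : HasCompactSupport (gradient ψ) :=
    (hψc.fderiv ℝ).comp_left (map_zero (InnerProductSpace.toDual ℝ _).symm)
  have hmem : MemLp (gradient ψ) (ENNReal.ofReal r) (volume.restrict Ω) :=
    hcont.memLp_of_hasCompactSupport hgc
  have hadm : IsAdmissible r Ω F G ψ (gradient ψ) :=
    ⟨⟨isWeakGradientOn_gradient hψ, hmem⟩, hψ.continuous.continuousOn,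
      ⟨tsupport ψ, hψc, hψG, fun x _ hx => image_eq_zero_of_notMem_tsupport hx⟩,
      fun x hx => (hψ1 x hx).self_of_nhds.ge⟩
  refine ne_top_of_le_ne_top ?_ (iInf_le_of_le ψ (iInf_le_of_le (gradient ψ) (iInf_le _ hadm)))
  exact ENNReal.rpow_ne_top_of_nonneg hr hmem.eLpNorm_ne_top

/-! ### Preimages under a homeomorphism -/

theorem preim_subset {n : ℕ} {Ω Ω' : Set (EuclideanSpace ℝ (Fin n))} (φ : Ω ≃ₜ Ω')
    (S : Set (EuclideanSpace ℝ (Fin n))) : preim φ S ⊆ Ω := by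
  rintro _ ⟨x, -, rfl⟩
  exact x.2

theorem preim_mono {n : ℕ} {Ω Ω' : Set (EuclideanSpace ℝ (Fin n))} (φ : Ω ≃ₜ Ω')
    {S T : Set (EuclideanSpace ℝ (Fin n))} (h : S ⊆ T) : preim φ S ⊆ preim φ T :=
  image_mono fun _ hx => h hx

theorem isOpen_preim {n : ℕ} {Ω Ω' : Set (EuclideanSpace ℝ (Fin n))} (hΩ : IsOpen Ω)
    (φ : Ω ≃ₜ Ω') {S : Set (EuclideanSpace ℝ (Fin n))} (hS : IsOpen S) : IsOpen (preim φ S) :=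
  hΩ.isOpenMap_subtype_val _ (hS.preimage (continuous_subtype_val.comp φ.continuous))

theorem preim_eq_image {n : ℕ} {Ω Ω' : Set (EuclideanSpace ℝ (Fin n))} (φ : Ω ≃ₜ Ω')
    (S : Set (EuclideanSpace ℝ (Fin n))) :
    preim φ S = (fun y : Ω' => (φ.symm y : EuclideanSpace ℝ (Fin n))) '' (Subtype.val ⁻¹' S) := by
  ext x
  constructor
  · rintro ⟨x, hx, rfl⟩
    exact ⟨φ x, hx, by simp⟩
  · rintro ⟨y, hy, rfl⟩
    exact ⟨φ.symm y, by simpa using hy, rfl⟩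

theorem isCompact_preim {n : ℕ} {Ω Ω' : Set (EuclideanSpace ℝ (Fin n))} (φ : Ω ≃ₜ Ω')
    {S : Set (EuclideanSpace ℝ (Fin n))} (hS : IsCompact S) (hSΩ : S ⊆ Ω') :
    IsCompact (preim φ S) := by
  rw [preim_eq_image]
  refine IsCompact.image ?_ (continuous_subtype_val.comp φ.symm.continuous)
  rwa [Topology.IsInducing.subtypeVal.isCompact_iff, Subtype.image_preimage_coe,
    inter_eq_right.2 hSΩ]

theorem preim_nonempty {n : ℕ} {Ω Ω' : Set (EuclideanSpace ℝ (Fin n))} (φ : Ω ≃ₜ Ω')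
    {S : Set (EuclideanSpace ℝ (Fin n))} (hS : S.Nonempty) (hSΩ : S ⊆ Ω') :
    (preim φ S).Nonempty := by
  obtain ⟨y, hy⟩ := hS
  exact ⟨_, φ.symm ⟨y, hSΩ hy⟩, by simpa using hy, rfl⟩

/-! ### The capacitary set function -/

theorem capSetFun_mono {n : ℕ} {p q : ℝ} {Ω Ω' A B : Set (EuclideanSpace ℝ (Fin n))}
    (φ : Ω ≃ₜ Ω') (h : A ⊆ B) : capSetFun p q φ A ≤ capSetFun p q φ B := by
  refine iSup_mono fun F => iSup_mono fun G => iSup_mono' fun ⟨h1, h2, h3⟩ =>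
    ⟨⟨h1, h2.trans h, h3⟩, le_rfl⟩

/-- A closed ball in a concentric open ball is a condenser whose preimage has non-zero capacity,
since the preimage of the closed ball has interior points. -/
theorem capSetFun_pos {n : ℕ} (hn : 1 ≤ n) {p q : ℝ} (hq : 1 < q) (hqp : q < p)
    {Ω Ω' A : Set (EuclideanSpace ℝ (Fin n))} (hΩ : IsOpen Ω) (hΩ' : IsOpen Ω') (φ : Ω ≃ₜ Ω')
    (hA : IsOpen A) (hAne : A.Nonempty) (hAΩ' : A ⊆ Ω') : 0 < capSetFun p q φ A := by
  obtain ⟨c, hc⟩ := hAne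
  obtain ⟨R, hR, hRA⟩ := Metric.nhds_basis_closedBall.mem_iff.1 (hA.mem_nhds hc)
  have hFG : Metric.closedBall c (R / 2) ⊆ Metric.ball c R :=
    Metric.closedBall_subset_ball (by linarith)
  have hGL : Metric.ball c R ⊆ Metric.closedBall c R := Metric.ball_subset_closedBall
  have hLΩ' : Metric.closedBall c R ⊆ Ω' := hRA.trans hAΩ'
  have hBF : Metric.ball c (R / 2) ⊆ Metric.closedBall c (R / 2) := Metric.ball_subset_closedBall
  have hBne : (Metric.ball c (R / 2)).Nonempty := ⟨c, Metric.mem_ball_self (by linarith)⟩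
  have hring : IsRingCondenser A (Metric.closedBall c (R / 2)) (Metric.ball c R) :=
    ⟨hFG, hGL.trans hRA, isCompact_closedBall _ _,
      (convex_closedBall _ _).isConnected (hBne.mono hBF), Metric.isOpen_ball,
      (convex_ball _ _).isConnected ⟨c, Metric.mem_ball_self hR⟩⟩
  have hp0 : capacity p Ω' (Metric.closedBall c (R / 2)) (Metric.ball c R) ≠ 0 :=
    capacity_ne_zero hn (hq.trans hqp) hΩ' (isCompact_closedBall c R) hGL hLΩ'
      ((hFG.trans hGL).trans hLΩ') (hBne.mono (interior_maximal hBF Metric.isOpen_ball))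
  have hpt : capacity p Ω' (Metric.closedBall c (R / 2)) (Metric.ball c R) ≠ ⊤ :=
    capacity_ne_top (by linarith) (isCompact_closedBall _ _) Metric.isOpen_ball hFG
  have hq0 : capacity q Ω (preim φ (Metric.closedBall c (R / 2)))
      (preim φ (Metric.ball c R)) ≠ 0 := by
    refine capacity_ne_zero hn hq hΩ (isCompact_preim φ (isCompact_closedBall c R) hLΩ')
      (preim_mono φ hGL) (preim_subset φ _) (preim_subset φ _) ?_
    exact (preim_nonempty φ hBne (((hBF.trans hFG).trans hGL).trans hLΩ')).mono
      (interior_maximal (preim_mono φ hBF) (isOpen_preim hΩ φ Metric.isOpen_ball))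
  have hexp : 0 ≤ p * q / (p - q) :=
    div_nonneg (mul_nonneg (by linarith) (by linarith)) (by linarith)
  refine lt_of_lt_of_le ?_ (le_iSup_of_le _ (le_iSup_of_le _ (le_iSup_of_le hring
    (le_iSup_of_le hp0 le_rfl))))
  refine ENNReal.rpow_pos_of_nonneg (ENNReal.div_pos ?_ ?_) hexp
  · exact (ENNReal.rpow_pos_of_nonneg hq0.bot_lt (by positivity)).ne'
  · exact ENNReal.rpow_ne_top_of_nonneg (one_div_nonneg.2 (by linarith)) hpt

end RingCap

theorem proposition4p1 {n : ℕ} (hn : 1 ≤ n) {p q : ℝ} (hq1 : 1 < q) (hqn : (n : ℝ) - 1 < q)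
    (hqp : q < p) {Ω Ω' : Set (EuclideanSpace ℝ (Fin n))}
    (hΩ : IsOpen Ω) (hΩc : IsConnected Ω) (hΩ' : IsOpen Ω') (hΩc' : IsConnected Ω')
    (φ : Ω ≃ₜ Ω') :
    (∀ A B : Set (EuclideanSpace ℝ (Fin n)), IsOpen A → IsOpen B → A ⊆ B → B ⊆ Ω' →
      RingCap.capSetFun p q φ A ≤ RingCap.capSetFun p q φ B) ∧
    (∀ A : Set (EuclideanSpace ℝ (Fin n)), IsOpen A → A.Nonempty → A ⊆ Ω' →
      0 < RingCap.capSetFun p q φ A) :=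
  ⟨fun _ _ _ _ hAB _ => RingCap.capSetFun_mono φ hAB,
    fun _ hA hne hAΩ' => RingCap.capSetFun_pos hn hq1 hqp hΩ hΩ' φ hA hne hAΩ'⟩
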